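/- Let $G$ be a finite group with $|G|\ge 4$, let $\sigma$ be an automorphism of $G$ of order two, and let $S$ be a multi-subset of $G$ of size $d$ (counted with multiplicity). Let $X_1=C(G,S)$, $X_2=C_\Sigma(G,S)$, $X_3=C(G,S)^\sigma$, $X_4=C_\Sigma(G,S)^\sigma$ be the Cayley graph, the Cayley sum graph, the twisted Cayley graph and the twisted Cayley sum graph: the multigraphs with vertex set $G$ in which, for every $x\in G$ and every $s\in S$ (with multiplicity), there is one edge from $x$ to $xs$, to $x^{-1}s$, to $\sigma(xs)$, to $\sigma(x^{-1}s)$, respectively. Loops and multiple edges are allowed. A multigraph is undirected if, for all $x,y$, as many edges go from $x$ to $y$ as from $y$ to $x$, and it is bipartite if its vertices can be coloured with two colours so that every edge joins vertices of different colours (so it has no loop). The spectrum is the multiset of eigenvalues of the adjacency operator. A nonempty vertex set $W$ has vertex boundary $\partial W$, the set of vertices outside $W$ adjacent to a vertex of $W$; a graph on $G$ is an $\varepsilon$-vertex expander if $|\partial W|\ge\varepsilon|W|$ for all nonempty $W\subseteq G$ with $|W|\le |G|/2$. A $d$-regular undirected graph is a two-sided $\varepsilon$-expander if it is connected and all nontrivial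 eigenvalues of its normalised adjacency operator ($\frac1d$ times the adjacency operator), i.e. those different from $\pm1$, lie in $(-1+\varepsilon,1-\varepsilon)$; it is a strict two-sided $\varepsilon$-expander if it is connected and all eigenvalues different from $1$ lie in $(-1+\varepsilon,1-\varepsilon)$. Let $i,j\in\{1,2,3,4\}$ (possibly equal) be such that $X_i$ and $X_j$ are undirected. If $\{i,j\}=\{2,3\}$, assume in addition that $S$ is symmetric, i.e. $S=S^{-1}$ as multisets. Put $$g_{ij}=\begin{cases} g & i=j,\\ g^{-1} & \{i,j\}=\{1,2\}\text{ or }\{3,4\},\\ \sigma(g) & \{i,j\}=\{1,3\}\text{ or }\{2,4\},\\ \sigma(g)^{-1} & \{i,j\}=\{1,4\}\text{ or }\{2,3\},\end{cases}$$ and let $f_{ij}$ be the number of $g\in G$ with $g=g_{ij}$. Let $\eta(X_1)=\eta(X_2)=0$ and $\eta(X_3)=\eta(X_4)=3$. Then: 1. There are multisets $\mathcal E_i^{+},\mathcal E_i^{-},\mathcal E_j^{+},\mathcal E_j^{-}$ of real numbers such that the spectrum of $X_i$ is the multiset union of $\mathcal E_i^{+}$ and $\mathcal E_i^{-}$, the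 spectrum of $X_j$ is the multiset union of $\mathcal E_j^{+}$ and $\mathcal E_j^{-}$, $\mathcal E_i^{+}=\mathcal E_j^{+}$ and $\mathcal E_i^{-}=-\mathcal E_j^{-}$ as multisets, $|\mathcal E_i^{+}|=(|G|+f_{ij})/2$ and $|\mathcal E_i^{-}|=(|G|-f_{ij})/2$. 2. $X_i$ is connected if and only if $X_j$ is connected. 3. $X_i$ is connected and bipartite if and only if $X_j$ is connected and bipartite. 4. For every $\varepsilon>0$, $X_i$ is a two-sided $\varepsilon$-expander if and only if $X_j$ is a two-sided $\varepsilon$-expander, and $X_i$ is a strict two-sided $\varepsilon$-expander if and only if $X_j$ is a strict two-sided $\varepsilon$-expander. 5. If $X_i$ and $X_j$ are connected, then $\operatorname{diam}(X_i)\le 2\operatorname{diam}(X_j)$ and $\operatorname{diam}(X_j)\le 2\operatorname{diam}(X_i)$. 6. Let $\varepsilon>0$ and suppose that $X_i$ is an $\varepsilon$-vertex expander. Put $$\delta=\frac{\varepsilon^4}{2^{9+\eta(X_i)}d^8}.$$ Then $\delta>0$ and $X_j$ is a two-sided $\delta$-expander. If moreover $X_i$ is not bipartite, then $X_j$ is a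 strict two-sided $\delta$-expander. -/

import Mathlib

/-- A directed multigraph on the vertex set `V` (loops allowed): `arcs x y` is the number of
edges from `x` to `y`. -/
structure MultiDigraph (V : Type*) where
  /-- The number of edges from `x` to `y`. -/
  arcs : V → V → ℕ

namespace MultiDigraph

/-- The multigraph is undirected: as many edges go from `x` to `y` as from `y` to `x`. -/
def IsUndirected {V : Type*} (Γ : MultiDigraph V) : Prop :=
  ∀ x y, Γ.arcs x y = Γ.arcs y x

/-- The simple graph obtained by forgetting directions, loops and multiplicities.  For an undirected
multigraph it carries the usual connectedness and path lengths. -/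
def toSimpleGraph {V : Type*} (Γ : MultiDigraph V) : SimpleGraph V :=
  SimpleGraph.fromRel fun x y => Γ.arcs x y ≠ 0

/-- Connectedness of an undirected multigraph. -/
def IsConnected {V : Type*} (Γ : MultiDigraph V) : Prop :=
  Γ.toSimpleGraph.Connected

/-- The diameter of a connected undirected multigraph. -/
noncomputable def diam {V : Type*} (Γ : MultiDigraph V) : ℕ :=
  Γ.toSimpleGraph.diam

/-- The vertices can be coloured by two colours so that every edge joins vertices of different
colours.  In particular there is no loop. -/
def IsBipartite {V : Type*} (Γ : MultiDigraph V) : Prop :=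
  ∃ c : V → Bool, ∀ x y, Γ.arcs x y ≠ 0 → c x ≠ c y

/-- The matrix of the adjacency operator. -/
def adjMatrix {V : Type*} (Γ : MultiDigraph V) : Matrix V V ℝ :=
  Matrix.of fun x y => (Γ.arcs x y : ℝ)

/-- The spectrum of an undirected multigraph: the multiset of the eigenvalues of its adjacency
operator.  The adjacency matrix is then real symmetric, so that all eigenvalues are real. -/
noncomputable def spectrum {V : Type*} [Fintype V] [DecidableEq V] (Γ : MultiDigraph V) :
    Multiset ℝ :=
  Γ.adjMatrix.charpoly.roots

/-- The vertex boundary of `W`: the vertices outside `W` that are adjacent to some vertex of `W`. -/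
def vertexBoundary {V : Type*} [Fintype V] [DecidableEq V] (Γ : MultiDigraph V) (W : Finset V) :
    Finset V :=
  Finset.univ.filter fun y => y ∉ W ∧ ∃ x ∈ W, Γ.arcs x y ≠ 0

/-- `Γ` is an `ε`-vertex expander: its vertex Cheeger constant is at least `ε`. -/
def IsVertexExpander {V : Type*} [Fintype V] [DecidableEq V] (Γ : MultiDigraph V) (ε : ℝ) : Prop :=
  ∀ W : Finset V, W.Nonempty → 2 * W.card ≤ Fintype.card V →
    ε * (W.card : ℝ) ≤ ((Γ.vertexBoundary W).card : ℝ)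

/-- A `d`-regular undirected multigraph is a two-sided `ε`-expander: it is connected and the
nontrivial eigenvalues of its normalised adjacency operator, that is, those different from `1` and
`-1`, lie in the interval `(-1 + ε, 1 - ε)`. -/
def IsTwoSidedExpander {V : Type*} [Fintype V] [DecidableEq V] (Γ : MultiDigraph V)
    (d : ℕ) (ε : ℝ) : Prop :=
  Γ.IsConnected ∧ ∀ t ∈ Γ.spectrum, t ≠ (d : ℝ) → t ≠ -(d : ℝ) →
    t / (d : ℝ) ∈ Set.Ioo (-1 + ε) (1 - ε)

/-- The variant of `IsTwoSidedExpander` in which only the eigenvalue `1` of the normalised adjacency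
operator counts as trivial. -/
def IsStrictTwoSidedExpander {V : Type*} [Fintype V] [DecidableEq V] (Γ : MultiDigraph V)
    (d : ℕ) (ε : ℝ) : Prop :=
  Γ.IsConnected ∧ ∀ t ∈ Γ.spectrum, t ≠ (d : ℝ) →
    t / (d : ℝ) ∈ Set.Ioo (-1 + ε) (1 - ε)

end MultiDigraph

/-- The four kinds of graphs attached to a group, a multi-subset and an automorphism. -/
inductive CayleyKind where
  /-- The Cayley graph. -/
  | cayley
  /-- The Cayley sum graph. -/
  | cayleySum
  /-- The twisted Cayley graph. -/
  | twisted
  /-- The twisted Cayley sum graph. -/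
  | twistedSum

namespace CayleyKind

/-- The end point of the edge that starts at `x` and is given by `s`. -/
def target {G : Type*} [Group G] (σ : MulAut G) : CayleyKind → G → G → G
  | cayley, x, s => x * s
  | cayleySum, x, s => x⁻¹ * s
  | twisted, x, s => σ (x * s)
  | twistedSum, x, s => σ (x⁻¹ * s)

/-- The graph of the given kind: for every `x` in `G` and every element `s` of the multiset `S`
(with multiplicity) there is one edge from `x` to `target σ k x s`. -/
def graph {G : Type*} [Group G] [DecidableEq G] (k : CayleyKind) (σ : MulAut G)
    (S : Multiset G) : MultiDigraph G where
  arcs x y := (S.map fun s => k.target σ x s).count y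

/-- The involution `g ↦ g_{ij}` that relates the graphs of the kinds `i` and `j`. -/
def involution {G : Type*} [Group G] (σ : MulAut G) : CayleyKind → CayleyKind → G → G
  | cayley, cayley, g => g
  | cayleySum, cayleySum, g => g
  | twisted, twisted, g => g
  | twistedSum, twistedSum, g => g
  | cayley, cayleySum, g => g⁻¹
  | cayleySum, cayley, g => g⁻¹
  | cayley, twisted, g => σ g
  | twisted, cayley, g => σ g
  | cayley, twistedSum, g => (σ g)⁻¹
  | twistedSum, cayley, g => (σ g)⁻¹
  | cayleySum, twisted, g => (σ g)⁻¹
  | twisted, cayleySum, g => (σ g)⁻¹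
  | cayleySum, twistedSum, g => σ g
  | twistedSum, cayleySum, g => σ g
  | twisted, twistedSum, g => g⁻¹
  | twistedSum, twisted, g => g⁻¹

/-- The number `f_{ij}` of solutions of `g = g_{ij}`. -/
def fixedCount {G : Type*} [Group G] [Fintype G] [DecidableEq G] (σ : MulAut G)
    (i j : CayleyKind) : ℕ :=
  (Finset.univ.filter fun g : G => g = involution σ i j g).card

/-- The exponent shift `η`. -/
def eta : CayleyKind → ℕ
  | cayley => 0
  | cayleySum => 0
  | twisted => 3
  | twistedSum => 3

end CayleyKind

/-! Each of the four adjacency operators arises from any other by moving the starting points of the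
edges with the involution `τ = involution σ i j`. If `T` is the permutation operator of `τ` and both
graphs are undirected, then `B = T A = A T`. Hence `A` and `B` preserve the `±1`-eigenspaces of `T`,
agree on the first and are opposite on the second. This is the statement on spectra, and the trace
of `T`, which counts its fixed points, gives the dimensions (`IsTwist.exists_spectrum_eq`).
Two-sided expansion is then passed on, since its condition on eigenvalues is invariant under sign.
Because `τ 1 = 1`, distances from `1` agree in the two graphs, which settles connectedness and
diameters (`IsTwist.edist_le`). A two-colouring of a connected one is `τ`-invariant, hence colours
the other as well.

It remains to pass from vertex expansion to two-sided expansion of the same graph. The top of the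
spectrum is Cheeger's inequality (`RegularWeights.variance_le_energy`). Near the bottom, an
eigenfunction `f` has almost constant `|f|`, by the same inequality applied to `|f|`. A plane of
eigenfunctions cannot have this property, so eigenvalues `t` near `-d` are simple. The square of the
adjacency operator commutes with left translations (`CayleyKind.exists_perm_sq`), and `-t` is not an
eigenvalue unless `t = -d`. So translations carry `f` to multiples of itself, necessarily by `±1`,
and `f` takes only the values `±f e`. The eigenvalue equation at `e` makes `t` an integer, and an
integer in `[-d, -d + 1)` is `-d`. -/

/-! ### Twists by an involution: distances, connectedness, colourings -/

namespace MultiDigraph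

variable {V : Type*} {Γ Δ : MultiDigraph V}

theorem edist_toSimpleGraph_le_one {x y : V} (h : Γ.arcs x y ≠ 0) :
    Γ.toSimpleGraph.edist x y ≤ 1 := by
  rw [SimpleGraph.edist_le_one_iff_adj_or_eq]
  by_cases hxy : x = y
  · exact Or.inr hxy
  · exact Or.inl ((SimpleGraph.fromRel_adj _ _ _).2 ⟨hxy, Or.inl h⟩)

theorem IsUndirected.arcs_ne_zero_of_adj (hΓ : Γ.IsUndirected) {x y : V}
    (h : Γ.toSimpleGraph.Adj x y) : Γ.arcs x y ≠ 0 := by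
  rcases ((SimpleGraph.fromRel_adj _ _ _).1 h).2 with h | h
  · exact h
  · rwa [hΓ x y]

/-- A property that spreads along edges holds everywhere on a connected multigraph as soon as it
holds somewhere. -/
theorem IsConnected.induction (hc : Γ.IsConnected) (hΓ : Γ.IsUndirected) {p : V → Prop}
    (hp : ∀ x y, Γ.arcs x y ≠ 0 → p x → p y) {e : V} (he : p e) (x : V) : p x := by
  obtain ⟨w⟩ := hc.preconnected e x
  induction w with
  | nil => exact he
  | cons h _ ih => exact ih (hp _ _ (hΓ.arcs_ne_zero_of_adj h) he)

/-- `Δ` arises from `Γ` by moving the starting points of the edges by an involution `τ`. -/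
structure IsTwist (τ : V → V) (Γ Δ : MultiDigraph V) : Prop where
  invol : Function.Involutive τ
  left : Γ.IsUndirected
  right : Δ.IsUndirected
  arcs_eq : ∀ x y, Δ.arcs x y = Γ.arcs (τ x) y

namespace IsTwist

variable {τ : V → V}

theorem symm (h : IsTwist τ Γ Δ) : IsTwist τ Δ Γ where
  invol := h.invol
  left := h.right
  right := h.left
  arcs_eq x y := by rw [h.arcs_eq, h.invol x]

theorem arcs_eq' (h : IsTwist τ Γ Δ) (x y : V) : Δ.arcs x y = Γ.arcs x (τ y) := by
  rw [h.right, h.arcs_eq, h.left]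

theorem arcs_map (h : IsTwist τ Γ Δ) (x y : V) : Γ.arcs (τ x) (τ y) = Γ.arcs x y := by
  rw [← h.arcs_eq, h.arcs_eq', h.invol y]

/-- An edge of `Δ` from `u` to `v` yields edges of `Γ` from `τ u` to `v` and from `u` to `τ v`. So a
walk in `Δ` becomes one of the same length in `Γ` after applying `τ` to every second vertex, counted
back from the end; the parity of the length decides the alternative, which disappears when `τ` fixes
the start. -/
theorem edist_le_or_edist_le (h : IsTwist τ Γ Δ) {u w : V} (p : Δ.toSimpleGraph.Walk u w) :
    Γ.toSimpleGraph.edist u w ≤ p.length ∨ Γ.toSimpleGraph.edist (τ u) w ≤ p.length := by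
  induction p with
  | nil => left; simp
  | @cons u v w hadj p ih =>
    have huv := h.right.arcs_ne_zero_of_adj hadj
    have h1 : Γ.toSimpleGraph.edist (τ u) v ≤ 1 :=
      edist_toSimpleGraph_le_one (by rwa [← h.arcs_eq])
    have h2 : Γ.toSimpleGraph.edist u (τ v) ≤ 1 :=
      edist_toSimpleGraph_le_one (by rwa [← h.arcs_eq'])
    rw [SimpleGraph.Walk.length_cons, Nat.cast_add, Nat.cast_one, add_comm]
    rcases ih with ih | ih
    · exact Or.inr (SimpleGraph.edist_triangle.trans (add_le_add h1 ih))
    · exact Or.inl (SimpleGraph.edist_triangle.trans (add_le_add h2 ih))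

theorem edist_le (h : IsTwist τ Γ Δ) {e : V} (he : τ e = e) (w : V) :
    Γ.toSimpleGraph.edist e w ≤ Δ.toSimpleGraph.edist e w := by
  by_cases hr : Δ.toSimpleGraph.edist e w = ⊤
  · rw [hr]; exact le_top
  · obtain ⟨p, hp⟩ := SimpleGraph.exists_walk_of_edist_ne_top hr
    rw [← hp]
    simpa [he] using h.edist_le_or_edist_le p

theorem ediam_le (h : IsTwist τ Γ Δ) {e : V} (he : τ e = e) :
    Γ.toSimpleGraph.ediam ≤ 2 * Δ.toSimpleGraph.ediam := by
  refine (Γ.toSimpleGraph.ediam_le_two_mul_eccent e).trans (mul_le_mul_right ?_ 2)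
  rw [SimpleGraph.eccent_le_iff]
  exact fun v => (h.edist_le he v).trans SimpleGraph.edist_le_ediam

theorem isConnected [Finite V] (h : IsTwist τ Γ Δ) {e : V} (he : τ e = e)
    (hΔ : Δ.IsConnected) : Γ.IsConnected := by
  have : Nonempty V := ⟨e⟩
  refine SimpleGraph.connected_of_ediam_ne_top (ne_top_of_le_ne_top ?_ (h.ediam_le he))
  exact WithTop.mul_ne_top (ENat.natCast_ne_top 2) (SimpleGraph.connected_iff_ediam_ne_top.1 hΔ)

theorem diam_le [Finite V] (h : IsTwist τ Γ Δ) {e : V} (he : τ e = e)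
    (hΔ : Δ.IsConnected) : Γ.diam ≤ 2 * Δ.diam := by
  have : Nonempty V := ⟨e⟩
  have := ENat.toNat_le_toNat (h.ediam_le he)
    (WithTop.mul_ne_top (ENat.natCast_ne_top 2) (SimpleGraph.connected_iff_ediam_ne_top.1 hΔ))
  rw [ENat.toNat_mul] at this
  exact this

theorem isBipartite (h : IsTwist τ Γ Δ) {e : V} (he : τ e = e)
    (hΔ : Δ.IsConnected) (hb : Δ.IsBipartite) : Γ.IsBipartite := by
  obtain ⟨c, hc⟩ := hb
  -- `τ` preserves the edges of `Δ`, and with only two colours the equality passes from one end of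
  -- an edge to the other, starting at the fixed point `e`.
  have key : ∀ x, c (τ x) = c x := by
    refine hΔ.induction h.right (p := fun x => c (τ x) = c x) (fun x y hxy hx => ?_) (e := e)
      (by rw [he])
    have h1 := hc _ _ hxy
    have h2 := hc (τ x) (τ y) (by rwa [h.symm.arcs_map])
    revert h1 h2 hx
    cases c x <;> cases c y <;> cases c (τ x) <;> cases c (τ y) <;> simp
  refine ⟨c, fun x y hxy => ?_⟩
  rw [h.symm.arcs_eq] at hxy
  rw [← key x]
  exact hc _ _ hxy

end IsTwist

end MultiDigraph

/-! ### Spectra of twisted graphs via the eigenspaces of the involution -/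

theorem LinearMap.eq_conj_prodMap_restrict {K E : Type*} [Field K] [AddCommGroup E] [Module K E]
    {p q : Submodule K E} (hpq : IsCompl p q) (f : E →ₗ[K] E)
    (hp : ∀ x ∈ p, f x ∈ p) (hq : ∀ x ∈ q, f x ∈ q) :
    f = (p.prodEquivOfIsCompl q hpq).conj ((f.restrict hp).prodMap (f.restrict hq)) := by
  ext x
  obtain ⟨y, rfl⟩ := (p.prodEquivOfIsCompl q hpq).surjective x
  simp [LinearEquiv.conj_apply]

theorem LinearMap.charpoly_eq_mul_restrict {K E : Type*} [Field K] [AddCommGroup E] [Module K E]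
    [FiniteDimensional K E] {p q : Submodule K E} (hpq : IsCompl p q) (f : E →ₗ[K] E)
    (hp : ∀ x ∈ p, f x ∈ p) (hq : ∀ x ∈ q, f x ∈ q) :
    f.charpoly = (f.restrict hp).charpoly * (f.restrict hq).charpoly := by
  conv_lhs => rw [f.eq_conj_prodMap_restrict hpq hp hq]
  rw [LinearEquiv.charpoly_conj, LinearMap.charpoly_prodMap]

theorem LinearMap.trace_eq_add_restrict {K E : Type*} [Field K] [AddCommGroup E] [Module K E]
    [FiniteDimensional K E] {p q : Submodule K E} (hpq : IsCompl p q) (f : E →ₗ[K] E)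
    (hp : ∀ x ∈ p, f x ∈ p) (hq : ∀ x ∈ q, f x ∈ q) :
    LinearMap.trace K E f =
      LinearMap.trace K p (f.restrict hp) + LinearMap.trace K q (f.restrict hq) := by
  conv_lhs => rw [f.eq_conj_prodMap_restrict hpq hp hq]
  rw [LinearMap.trace_conj', LinearMap.trace_prodMap']

theorem LinearMap.roots_charpoly_neg {E : Type*} [AddCommGroup E] [Module ℝ E]
    [FiniteDimensional ℝ E] (f : E →ₗ[ℝ] E) :
    (-f).charpoly.roots = f.charpoly.roots.map fun t => -t := by
  have h : (-f).charpoly =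
      Polynomial.C ((-1) ^ Module.finrank ℝ E) * f.charpoly.comp (-Polynomial.X) := by
    refine Polynomial.funext fun r => ?_
    rw [Polynomial.eval_mul, Polynomial.eval_C, Polynomial.eval_comp, LinearMap.eval_charpoly,
      LinearMap.eval_charpoly, ← LinearMap.det_smul]
    congr 1
    ext x
    simp [add_comm]
  rw [h, Polynomial.roots_C_mul _ (pow_ne_zero _ (by norm_num)), Polynomial.roots_comp_neg_X]

namespace MultiDigraph

theorem IsUndirected.isHermitian {V : Type*} {Γ : MultiDigraph V} (hΓ : Γ.IsUndirected) : Γ.adjMatrix.IsHermitian := by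
  ext x y
  simp [adjMatrix, hΓ x y]

variable {V : Type*} [Fintype V] [DecidableEq V] {Γ Δ : MultiDigraph V}

theorem mem_spectrum_iff {t : ℝ} :
    t ∈ Γ.spectrum ↔ ∃ f : V → ℝ, f ≠ 0 ∧ ∀ x, ∑ y, (Γ.arcs x y : ℝ) * f y = t * f x := by
  rw [spectrum, Polynomial.mem_roots (Matrix.charpoly_monic _).ne_zero, ← Matrix.charpoly_toLin',
    ← Module.End.hasEigenvalue_iff_isRoot_charpoly]
  constructor
  · intro h
    obtain ⟨f, hf⟩ := h.exists_hasEigenvector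
    refine ⟨f, hf.2, fun x => ?_⟩
    have := congrFun hf.apply_eq_smul x
    simpa [Matrix.toLin'_apply, Matrix.mulVec, dotProduct, adjMatrix] using this
  · rintro ⟨f, hf, h⟩
    refine Module.End.hasEigenvalue_of_hasEigenvector (x := f)
      ⟨Module.End.mem_eigenspace_iff.2 ?_, hf⟩
    ext x
    simpa [Matrix.toLin'_apply, Matrix.mulVec, dotProduct, adjMatrix] using h x

namespace IsTwist

variable {τ : V → V}

theorem exists_spectrum_eq (h : IsTwist τ Γ Δ) :
    ∃ P M : Multiset ℝ, Γ.spectrum = P + M ∧ Δ.spectrum = P + M.map (fun t => -t) ∧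
      2 * P.card = Fintype.card V + (Finset.univ.filter fun x => x = τ x).card ∧
      2 * M.card + (Finset.univ.filter fun x => x = τ x).card = Fintype.card V := by
  set A : (V → ℝ) →ₗ[ℝ] (V → ℝ) := Γ.adjMatrix.toLin' with hA
  set B : (V → ℝ) →ₗ[ℝ] (V → ℝ) := Δ.adjMatrix.toLin' with hB
  set T : (V → ℝ) →ₗ[ℝ] (V → ℝ) := LinearMap.funLeft ℝ ℝ τ with hT
  have hTT : ∀ f, T (T f) = f := fun f => by
    ext x; simp [hT, LinearMap.funLeft_apply, h.invol x]
  have hTA : ∀ f, T (A f) = B f := fun f => by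
    ext x
    simp [hT, hA, hB, LinearMap.funLeft_apply, Matrix.mulVec, dotProduct, adjMatrix, h.arcs_eq]
  have hAT : ∀ f, A (T f) = B f := fun f => by
    ext x
    simp only [hT, hA, hB, Matrix.toLin'_apply, Matrix.mulVec, dotProduct, adjMatrix,
      Matrix.of_apply, LinearMap.funLeft_apply]
    exact Fintype.sum_equiv h.invol.toPerm _ _ fun y => by
      simp [h.arcs_eq', h.invol y]
  let p : Submodule ℝ (V → ℝ) := LinearMap.ker (T - LinearMap.id)
  let q : Submodule ℝ (V → ℝ) := LinearMap.ker (T + LinearMap.id)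
  have mp : ∀ f, f ∈ p ↔ T f = f := fun f => by
    simp [p, LinearMap.mem_ker, sub_eq_zero]
  have mq : ∀ f, f ∈ q ↔ T f = -f := fun f => by
    simp [q, LinearMap.mem_ker, add_eq_zero_iff_eq_neg]
  have hpq : IsCompl p q := by
    refine IsCompl.of_eq ?_ ?_
    · rw [Submodule.eq_bot_iff]
      rintro f ⟨h1, h2⟩
      exact self_eq_neg.1 (((mp f).1 h1).symm.trans ((mq f).1 h2))
    · rw [Submodule.eq_top_iff']
      intro f
      rw [Submodule.mem_sup]
      refine ⟨(1 / 2 : ℝ) • (f + T f), (mp _).2 ?_, (1 / 2 : ℝ) • (f - T f), (mq _).2 ?_, ?_⟩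
      · rw [map_smul, map_add, hTT, add_comm]
      · rw [map_smul, map_sub, hTT, ← smul_neg, neg_sub]
      · rw [← smul_add, add_add_sub_cancel, ← two_smul ℝ, smul_smul]; norm_num
  have Tp : ∀ f ∈ p, T f ∈ p := fun f hf => by rwa [(mp f).1 hf]
  have Tq : ∀ f ∈ q, T f ∈ q := fun f hf => by
    rw [(mq f).1 hf]; exact q.neg_mem hf
  have BA : ∀ f ∈ p, B f = A f := fun f hf => by rw [← hAT, (mp f).1 hf]
  have BA' : ∀ f ∈ q, B f = -A f := fun f hf => by rw [← hAT, (mq f).1 hf, map_neg]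
  have Ap : ∀ f ∈ p, A f ∈ p := fun f hf => (mp _).2 (by rw [hTA, BA f hf])
  have Aq : ∀ f ∈ q, A f ∈ q := fun f hf => (mq _).2 (by rw [hTA, BA' f hf])
  have Bp : ∀ f ∈ p, B f ∈ p := fun f hf => by rw [BA f hf]; exact Ap f hf
  have Bq : ∀ f ∈ q, B f ∈ q := fun f hf => by rw [BA' f hf]; exact q.neg_mem (Aq f hf)
  have rB : B.restrict Bp = A.restrict Ap := by
    ext1 f; exact Subtype.ext (BA f f.2)
  have rB' : B.restrict Bq = -A.restrict Aq := by
    ext1 f; exact Subtype.ext (BA' f f.2)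
  have rT : T.restrict Tp = LinearMap.id := by
    ext1 f; exact Subtype.ext ((mp _).1 f.2)
  have rT' : T.restrict Tq = (-1 : ℝ) • LinearMap.id := by
    ext1 f; exact Subtype.ext (((mq _).1 f.2).trans (neg_one_smul ℝ _).symm)
  have cA := A.charpoly_eq_mul_restrict hpq Ap Aq
  have cB := B.charpoly_eq_mul_restrict hpq Bp Bq
  have n1 := (A.restrict Ap).charpoly_monic.ne_zero
  have n2 := (A.restrict Aq).charpoly_monic.ne_zero
  have n3 := (-A.restrict Aq).charpoly_monic.ne_zero
  -- A real symmetric matrix has only real eigenvalues, so each factor of the characteristic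
  -- polynomial has as many roots as its degree.
  have hs : A.charpoly.Splits := by
    rw [hA, Matrix.charpoly_toLin']; exact h.left.isHermitian.splits_charpoly
  have hn := A.charpoly_monic.ne_zero
  have s1 : (A.restrict Ap).charpoly.roots.card = Module.finrank ℝ p := by
    rw [← (hs.of_dvd hn (cA ▸ dvd_mul_right _ _)).natDegree_eq_card_roots,
      LinearMap.charpoly_natDegree]
  have s2 : (A.restrict Aq).charpoly.roots.card = Module.finrank ℝ q := by
    rw [← (hs.of_dvd hn (cA ▸ dvd_mul_left _ _)).natDegree_eq_card_roots,
      LinearMap.charpoly_natDegree]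
  have dim : Module.finrank ℝ p + Module.finrank ℝ q = Fintype.card V := by
    rw [Submodule.finrank_add_eq_of_isCompl hpq, Module.finrank_fintype_fun_eq_card]
  -- The trace of `T` is computed twice: from its eigenspaces, and as a permutation matrix.
  have tr : (Module.finrank ℝ p : ℝ) - Module.finrank ℝ q =
      (Finset.univ.filter fun x => x = τ x).card := by
    have h1 := T.trace_eq_add_restrict hpq Tp Tq
    rw [rT, rT', map_smul, LinearMap.trace_id, LinearMap.trace_id, smul_eq_mul, neg_one_mul,
      ← sub_eq_add_neg] at h1
    rw [← h1, LinearMap.trace_eq_matrix_trace ℝ (Pi.basisFun ℝ V), Matrix.trace,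
      Finset.card_filter, Nat.cast_sum]
    refine Finset.sum_congr rfl fun x _ => ?_
    simp [hT, LinearMap.funLeft_apply, Pi.single_apply, eq_comm]
  have tr' : Module.finrank ℝ p =
      Module.finrank ℝ q + (Finset.univ.filter fun x => x = τ x).card := by
    have : (Module.finrank ℝ p : ℝ) =
      Module.finrank ℝ q + (Finset.univ.filter fun x => x = τ x).card := by linarith
    exact_mod_cast this
  refine ⟨(A.restrict Ap).charpoly.roots, (A.restrict Aq).charpoly.roots, ?_, ?_, ?_, ?_⟩
  · rw [spectrum, ← Matrix.charpoly_toLin', ← hA, cA, Polynomial.roots_mul (mul_ne_zero n1 n2)]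
  · rw [spectrum, ← Matrix.charpoly_toLin', ← hB, cB, rB, rB',
      Polynomial.roots_mul (mul_ne_zero n1 n3), LinearMap.roots_charpoly_neg]
  · omega
  · omega

theorem mem_spectrum_or_neg_mem (h : IsTwist τ Γ Δ) {t : ℝ} (ht : t ∈ Δ.spectrum) :
    t ∈ Γ.spectrum ∨ -t ∈ Γ.spectrum := by
  obtain ⟨P, M, hΓ, hΔ, -⟩ := h.exists_spectrum_eq
  rw [hΔ, Multiset.mem_add, Multiset.mem_map] at ht
  rw [hΓ, Multiset.mem_add, Multiset.mem_add]
  rcases ht with ht | ⟨s, hs, rfl⟩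
  · exact Or.inl (Or.inl ht)
  · exact Or.inr (Or.inr (by rwa [neg_neg]))

end IsTwist

end MultiDigraph

/-! ### Isoperimetry and Cheeger's inequality -/

/-- The weights `a` expand every set of at most half of the points: a discrete isoperimetric
inequality with constant `ε`. -/
def EdgeExpansion {V : Type*} [Fintype V] [DecidableEq V] (a : V → V → ℝ) (ε : ℝ) : Prop :=
  ∀ W : Finset V, W.Nonempty → 2 * W.card ≤ Fintype.card V →
    ε * W.card ≤ ∑ x, ∑ y, if x ∈ W ∧ y ∉ W then a x y else 0

/-- Symmetric nonnegative weights with all row sums equal to `d`. -/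
structure RegularWeights {V : Type*} [Fintype V] (a : V → V → ℝ) (d : ℝ) : Prop where
  nonneg : ∀ x y, 0 ≤ a x y
  symm : ∀ x y, a x y = a y x
  sum_eq : ∀ x, ∑ y, a x y = d

theorem exists_median {V : Type*} [Fintype V] [Nonempty V] (u : V → ℝ) :
    ∃ m, 2 * (Finset.univ.filter fun x => m < u x).card ≤ Fintype.card V ∧
      2 * (Finset.univ.filter fun x => u x < m).card ≤ Fintype.card V := by
  classical
  -- The median is the smallest attained value that at most half of the points exceed.
  let T := Finset.univ.filter fun z => 2 * (Finset.univ.filter fun x => u z < u x).card ≤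
    Fintype.card V
  have hT : T.Nonempty := by
    obtain ⟨z, -, hz⟩ := Finset.exists_max_image Finset.univ u Finset.univ_nonempty
    refine ⟨z, Finset.mem_filter.2 ⟨Finset.mem_univ _, ?_⟩⟩
    rw [Finset.filter_false_of_mem (fun x hx => not_lt.2 (hz x hx))]
    simp
  obtain ⟨z, hzT, hz⟩ := Finset.exists_min_image T u hT
  refine ⟨u z, (Finset.mem_filter.1 hzT).2, ?_⟩
  rcases (Finset.univ.filter fun x => u x < u z).eq_empty_or_nonempty with h | h
  · rw [h]; simp
  obtain ⟨y, hy, hmax⟩ := Finset.exists_max_image _ u h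
  have hyz := (Finset.mem_filter.1 hy).2
  have hyT : y ∉ T := fun hyT => not_lt.2 (hz y hyT) hyz
  have hy2 : Fintype.card V < 2 * (Finset.univ.filter fun x => u y < u x).card := by
    by_contra hcon
    exact hyT (Finset.mem_filter.2 ⟨Finset.mem_univ _, not_lt.1 hcon⟩)
  have hdisj : Disjoint (Finset.univ.filter fun x => u x < u z)
      (Finset.univ.filter fun x => u y < u x) := by
    rw [Finset.disjoint_left]
    intro x hx hx'
    exact not_lt.2 (hmax x hx) (Finset.mem_filter.1 hx').2
  have := Finset.card_union_of_disjoint hdisj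
  have h3 := Finset.card_le_univ
    ((Finset.univ.filter fun x => u x < u z) ∪ (Finset.univ.filter fun x => u y < u x))
  omega

section Energy

variable {V : Type*} [Fintype V] {a : V → V → ℝ} {d ε : ℝ}

/-- Co-area inequality. -/
theorem EdgeExpansion.coarea [DecidableEq V] (h : EdgeExpansion a ε) (k : ℕ) :
    ∀ g : V → ℝ, (∀ x, 0 ≤ g x) → (Finset.univ.filter fun x => g x ≠ 0).card = k →
      2 * k ≤ Fintype.card V →
      ε * ∑ x, g x ≤ ∑ x, ∑ y, a x y * max (g x - g y) 0 := by
  induction k using Nat.strong_induction_on with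
  | _ k ih =>
  intro g hg hk hk2
  set W := Finset.univ.filter fun x => g x ≠ 0 with hW
  have memW : ∀ x, x ∈ W ↔ g x ≠ 0 := fun x => by simp [hW]
  rcases W.eq_empty_or_nonempty with h0 | hne
  · have : ∀ x, g x = 0 := fun x => by
      by_contra hx
      have := (memW x).2 hx
      simp [h0] at this
    simp [this]
  obtain ⟨z, hz, hmin⟩ := Finset.exists_min_image W g hne
  set m := g z
  have hm : 0 ≤ m := hg z
  -- The lowest layer, of height `m` over the support `W`, is peeled off: isoperimetry for `W`
  -- accounts for it, and the induction hypothesis for the rest, whose support has lost `z`.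
  let g' : V → ℝ := fun x => if x ∈ W then g x - m else 0
  have hg' : ∀ x, 0 ≤ g' x := fun x => by
    by_cases hx : x ∈ W
    · simpa [g', hx] using hmin x hx
    · simp [g', hx]
  have hsub : (Finset.univ.filter fun x => g' x ≠ 0) ⊆ W.erase z := by
    intro x hx
    have hx := (Finset.mem_filter.1 hx).2
    rw [Finset.mem_erase]
    by_cases hxW : x ∈ W
    · refine ⟨?_, hxW⟩
      rintro rfl
      exact hx (by simp [g', hxW, m])
    · exact absurd (by simp [g', hxW]) hx
  have hlt : (Finset.univ.filter fun x => g' x ≠ 0).card < k := by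
    refine (Finset.card_le_card hsub).trans_lt ?_
    rw [← hk]
    exact Finset.card_erase_lt_of_mem hz
  have h1 := ih _ hlt g' hg' rfl (by omega)
  have h2 := h W hne (by omega)
  have hsum : ∑ x, g x = ∑ x, g' x + W.card * m := by
    have : ∀ x, g x = g' x + if x ∈ W then m else 0 := fun x => by
      by_cases hx : x ∈ W
      · simp [g', hx]
      · have : g x = 0 := by simpa [memW] using hx
        simp [g', hx, this]
    rw [Finset.sum_congr rfl fun x _ => this x, Finset.sum_add_distrib]
    simp [Finset.sum_ite_mem]
  have hpt : ∀ x y, a x y * max (g x - g y) 0 =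
      a x y * max (g' x - g' y) 0 + m * (if x ∈ W ∧ y ∉ W then a x y else 0) := fun x y => by
    by_cases hx : x ∈ W <;> by_cases hy : y ∈ W
    · simp [g', hx, hy]
    · have hy0 : g y = 0 := by simpa [memW] using hy
      have := hmin x hx
      simp only [g', hx, hy, hy0, if_true, if_false, not_false_eq_true, and_self, sub_zero]
      rw [max_eq_left (hg x), max_eq_left (by linarith)]
      ring
    · have hx0 : g x = 0 := by simpa [memW] using hx
      have := hmin y hy
      simp only [g', hx, hy, hx0, if_true, if_false, false_and]
      rw [max_eq_right (by linarith [hg y]), max_eq_right (by linarith)]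
      ring
    · have hx0 : g x = 0 := by simpa [memW] using hx
      have hy0 : g y = 0 := by simpa [memW] using hy
      simp [g', hx, hy, hx0, hy0]
  simp_rw [hpt, Finset.sum_add_distrib, ← Finset.mul_sum]
  rw [hsum]
  nlinarith [mul_le_mul_of_nonneg_left h2 hm]

namespace RegularWeights

theorem sum_sq_left (h : RegularWeights a d) (u : V → ℝ) :
    ∑ x, ∑ y, a x y * u x = d * ∑ x, u x := by
  simp_rw [← Finset.sum_mul, h.sum_eq, Finset.mul_sum]

theorem sum_sq_right (h : RegularWeights a d) (u : V → ℝ) :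
    ∑ x, ∑ y, a x y * u y = d * ∑ x, u x := by
  rw [Finset.sum_comm, ← h.sum_sq_left u]
  exact Finset.sum_congr rfl fun x _ => Finset.sum_congr rfl fun y _ => by rw [h.symm]

theorem le_energy_of_support [DecidableEq V] (h : RegularWeights a d) (hd : 0 < d) (hε : 0 < ε)
    (he : EdgeExpansion a ε) (w : V → ℝ)
    (hs : 2 * (Finset.univ.filter fun x => w x ≠ 0).card ≤ Fintype.card V) :
    ε ^ 2 * ∑ x, w x ^ 2 ≤ d * ∑ x, ∑ y, a x y * (w x - w y) ^ 2 := by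
  have h1 := he.coarea _ (fun x => w x ^ 2) (fun x => sq_nonneg _) rfl (by
    simpa using hs)
  have h2 : ∑ x, ∑ y, a x y * max (w x ^ 2 - w y ^ 2) 0 =
      ∑ x, ∑ y, a x y * max (w y ^ 2 - w x ^ 2) 0 := by
    rw [Finset.sum_comm]
    exact Finset.sum_congr rfl fun x _ => Finset.sum_congr rfl fun y _ => by rw [h.symm]
  have h3 : ∑ x, ∑ y, (4 * d * ε) * (a x y * max (w x ^ 2 - w y ^ 2) 0 +
      a x y * max (w y ^ 2 - w x ^ 2) 0) ≤
      ∑ x, ∑ y, ((4 * d ^ 2) * (a x y * (w x - w y) ^ 2) +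
        (2 * ε ^ 2) * (a x y * w x ^ 2 + a x y * w y ^ 2)) := by
    refine Finset.sum_le_sum fun x _ => Finset.sum_le_sum fun y _ => ?_
    -- With `|w x ^ 2 - w y ^ 2| = |w x - w y| * |w x + w y|`, this is AM-GM weighted so that, after
    -- summation, the `w ^ 2` terms absorb exactly half of the co-area bound.
    have key : (4 * d * ε) * (max (w x ^ 2 - w y ^ 2) 0 + max (w y ^ 2 - w x ^ 2) 0) ≤
        (4 * d ^ 2) * (w x - w y) ^ 2 + (2 * ε ^ 2) * (w x ^ 2 + w y ^ 2) := by
      rcases le_total (w x ^ 2) (w y ^ 2) with hxy | hxy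
      · rw [max_eq_right (by linarith), max_eq_left (by linarith)]
        nlinarith [sq_nonneg (2 * d * (w y - w x) - ε * (w x + w y)),
          sq_nonneg (ε * (w x - w y))]
      · rw [max_eq_left (by linarith), max_eq_right (by linarith)]
        nlinarith [sq_nonneg (2 * d * (w x - w y) - ε * (w x + w y)),
          sq_nonneg (ε * (w x - w y))]
    have := mul_le_mul_of_nonneg_left key (h.nonneg x y)
    linarith
  simp_rw [Finset.sum_add_distrib, ← Finset.mul_sum, Finset.sum_add_distrib] at h3
  rw [← h2, h.sum_sq_left fun x => w x ^ 2, h.sum_sq_right fun x => w x ^ 2] at h3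
  have h4 := mul_le_mul_of_nonneg_left h1 (by positivity : 0 ≤ 8 * d * ε)
  have h5 : 4 * d * (ε ^ 2 * ∑ x, w x ^ 2) ≤
      4 * d * (d * ∑ x, ∑ y, a x y * (w x - w y) ^ 2) := by linarith
  exact le_of_mul_le_mul_left h5 (by positivity)

/-- Cheeger's inequality. -/
theorem variance_le_energy [DecidableEq V] [Nonempty V] (h : RegularWeights a d) (hd : 0 < d) (hε : 0 < ε)
    (he : EdgeExpansion a ε) (u : V → ℝ) :
    ε ^ 2 * (Fintype.card V * ∑ x, u x ^ 2 - (∑ x, u x) ^ 2) ≤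
      Fintype.card V * (d * ∑ x, ∑ y, a x y * (u x - u y) ^ 2) := by
  obtain ⟨m, hm1, hm2⟩ := exists_median u
  -- The parts of `u` above and below a median are each supported on at most half of the points.
  have h1 := h.le_energy_of_support hd hε he (fun x => max (u x - m) 0) (by
      convert hm1 using 4 with x
      simp)
  have h2 := h.le_energy_of_support hd hε he (fun x => max (m - u x) 0) (by
      convert hm2 using 4 with x
      simp)
  have hmax : ∀ x, (u x ≤ m ∧ max (u x - m) 0 = 0 ∧ max (m - u x) 0 = m - u x) ∨
      (m ≤ u x ∧ max (u x - m) 0 = u x - m ∧ max (m - u x) 0 = 0) := fun x =>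
    (le_total (u x) m).imp
      (fun hx => ⟨hx, max_eq_right (by linarith), max_eq_left (by linarith)⟩)
      (fun hx => ⟨hx, max_eq_left (by linarith), max_eq_right (by linarith)⟩)
  have h3 : ∑ x, (u x - m) ^ 2 = ∑ x, max (u x - m) 0 ^ 2 + ∑ x, max (m - u x) 0 ^ 2 := by
    rw [← Finset.sum_add_distrib]
    refine Finset.sum_congr rfl fun x _ => ?_
    rcases hmax x with ⟨hx, ex, ex'⟩ | ⟨hx, ex, ex'⟩ <;> rw [ex, ex'] <;> ring
  have h4 : ∑ x, ∑ y, a x y * (max (u x - m) 0 - max (u y - m) 0) ^ 2 +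
      ∑ x, ∑ y, a x y * (max (m - u x) 0 - max (m - u y) 0) ^ 2 ≤
      ∑ x, ∑ y, a x y * (u x - u y) ^ 2 := by
    simp_rw [← Finset.sum_add_distrib, ← mul_add]
    refine Finset.sum_le_sum fun x _ => Finset.sum_le_sum fun y _ =>
      mul_le_mul_of_nonneg_left ?_ (h.nonneg x y)
    rcases hmax x with ⟨hx, ex, ex'⟩ | ⟨hx, ex, ex'⟩ <;>
      rcases hmax y with ⟨hy, ey, ey'⟩ | ⟨hy, ey, ey'⟩ <;> rw [ex, ex', ey, ey'] <;>
      nlinarith [mul_nonneg (sub_nonneg.2 hx) (sub_nonneg.2 hy)]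
  have h5 : ε ^ 2 * ∑ x, (u x - m) ^ 2 ≤ d * ∑ x, ∑ y, a x y * (u x - u y) ^ 2 := by
    have := mul_le_mul_of_nonneg_left h4 hd.le
    rw [h3]
    linarith
  have h6 : ∑ x, (u x - m) ^ 2 =
      ∑ x, u x ^ 2 - 2 * m * ∑ x, u x + Fintype.card V * m ^ 2 := by
    simp_rw [sub_sq, Finset.sum_add_distrib, Finset.sum_sub_distrib, Finset.mul_sum]
    simp [mul_comm, mul_left_comm]
  refine le_trans ?_ (mul_le_mul_of_nonneg_left h5 (Nat.cast_nonneg _))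
  rw [h6]
  -- Second moments about `m` dominate those about the mean.
  nlinarith [sq_nonneg (ε * (∑ x, u x - Fintype.card V * m))]

end RegularWeights

end Energy

/-! ### Eigenvalues near the two ends of the spectrum -/

/-- `f` satisfies the eigenvalue equation for the weights `a` and the eigenvalue `t`. -/
def IsEigen {V : Type*} [Fintype V] (a : V → V → ℝ) (t : ℝ) (f : V → ℝ) : Prop :=
  ∀ x, ∑ y, a x y * f y = t * f x

section Eigen

variable {V : Type*} [Fintype V] {a : V → V → ℝ} {d ε t : ℝ} {f g : V → ℝ}

theorem IsEigen.smul (hf : IsEigen a t f) (c : ℝ) : IsEigen a t (c • f) := fun x => by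
  simp only [Pi.smul_apply, smul_eq_mul, mul_left_comm _ c, ← Finset.mul_sum, hf x]

theorem IsEigen.add (hf : IsEigen a t f) (hg : IsEigen a t g) : IsEigen a t (f + g) := fun x => by
  simp only [Pi.add_apply, mul_add, Finset.sum_add_distrib, hf x, hg x]

theorem sum_sq_pos (hf : f ≠ 0) : 0 < ∑ x, f x ^ 2 := by
  obtain ⟨x, hx⟩ := Function.ne_iff.1 hf
  exact Finset.sum_pos' (fun _ _ => sq_nonneg _)
    ⟨x, Finset.mem_univ _, lt_of_le_of_ne (sq_nonneg _) (pow_ne_zero 2 hx).symm⟩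

/-- A matrix whose square commutes with a map on functions: the eigenvalue equation is transported
unless `-t` is an eigenvalue as well. -/
theorem IsEigen.of_sq (h : ∀ x, ∑ y, a x y * ∑ z, a y z * g z = t ^ 2 * g x)
    (hneg : ∀ k, IsEigen a (-t) k → k = 0) : IsEigen a t g := by
  have := hneg (fun x => ∑ y, a x y * g y - t * g x) fun x => by
    simp only [mul_sub, Finset.sum_sub_distrib, h, mul_left_comm _ t, ← Finset.mul_sum]
    ring
  exact fun x => sub_eq_zero.1 (congrFun this x)

namespace RegularWeights

theorem sum_mul_sq_sub (h : RegularWeights a d) (hf : IsEigen a t f) :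
    ∑ x, ∑ y, a x y * (f x - f y) ^ 2 = 2 * (d - t) * ∑ x, f x ^ 2 := by
  have h1 : ∑ x, ∑ y, f x * (a x y * f y) = t * ∑ x, f x ^ 2 := by
    simp_rw [← Finset.mul_sum, hf _, Finset.mul_sum]
    exact Finset.sum_congr rfl fun x _ => by ring
  have h2 : ∀ x y, a x y * (f x - f y) ^ 2 =
      a x y * f x ^ 2 + a x y * f y ^ 2 - 2 * (f x * (a x y * f y)) := fun x y => by ring
  simp_rw [h2, Finset.sum_sub_distrib, Finset.sum_add_distrib]
  rw [h.sum_sq_left fun x => f x ^ 2, h.sum_sq_right fun x => f x ^ 2]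
  simp_rw [← Finset.mul_sum] at h1 ⊢
  rw [h1]
  ring

theorem sum_mul_sq_add (h : RegularWeights a d) (hf : IsEigen a t f) :
    ∑ x, ∑ y, a x y * (f x + f y) ^ 2 = 2 * (d + t) * ∑ x, f x ^ 2 := by
  have h1 : ∑ x, ∑ y, f x * (a x y * f y) = t * ∑ x, f x ^ 2 := by
    simp_rw [← Finset.mul_sum, hf _, Finset.mul_sum]
    exact Finset.sum_congr rfl fun x _ => by ring
  have h2 : ∀ x y, a x y * (f x + f y) ^ 2 =
      a x y * f x ^ 2 + a x y * f y ^ 2 + 2 * (f x * (a x y * f y)) := fun x y => by ring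
  simp_rw [h2, Finset.sum_add_distrib]
  rw [h.sum_sq_left fun x => f x ^ 2, h.sum_sq_right fun x => f x ^ 2]
  simp_rw [← Finset.mul_sum] at h1 ⊢
  rw [h1]
  ring

theorem neg_le_eigenvalue (h : RegularWeights a d) (hf : IsEigen a t f) (hf0 : f ≠ 0) :
    -d ≤ t := by
  have h1 := h.sum_mul_sq_add hf
  have h2 : 0 ≤ ∑ x, ∑ y, a x y * (f x + f y) ^ 2 :=
    Finset.sum_nonneg fun x _ => Finset.sum_nonneg fun y _ =>
      mul_nonneg (h.nonneg x y) (sq_nonneg _)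
  rw [h1] at h2
  have := nonneg_of_mul_nonneg_left h2 (sum_sq_pos hf0)
  linarith

variable [DecidableEq V] [Nonempty V]

theorem gap_of_ne (h : RegularWeights a d) (hd : 0 < d) (hε : 0 < ε) (he : EdgeExpansion a ε)
    (hf : IsEigen a t f) (hf0 : f ≠ 0) (ht : t ≠ d) : ε ^ 2 ≤ 2 * d * (d - t) := by
  have h1 : ∑ x, f x = 0 := by
    have h2 := h.sum_sq_right f
    simp_rw [hf _, ← Finset.mul_sum] at h2
    by_contra hne
    exact ht (mul_right_cancel₀ hne h2)
  have h2 := h.variance_le_energy hd hε he f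
  rw [h.sum_mul_sq_sub hf, h1] at h2
  have hn : (0 : ℝ) < Fintype.card V := Nat.cast_pos.2 Fintype.card_pos
  have hp : 0 < Fintype.card V * ∑ x, f x ^ 2 := mul_pos hn (sum_sq_pos hf0)
  refine le_of_mul_le_mul_right ?_ hp
  linarith

/-- Since `||f x| - |f y|| ≤ |f x + f y|`, the energy of `|f|` is at most `2 * (d + t) * ∑ x, f x ^
2`. Cheeger's inequality then bounds the variance of `|f|` by a sixteenth of its second moment. -/
theorem sum_sq_le_sum_abs (h : RegularWeights a d) (hd : 0 < d) (hε : 0 < ε)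
    (he : EdgeExpansion a ε) (hf : IsEigen a t f) (ht : 32 * d * (d + t) ≤ ε ^ 2) :
    15 / 16 * (Fintype.card V * ∑ x, f x ^ 2) ≤ (∑ x, |f x|) ^ 2 := by
  have h1 := h.variance_le_energy hd hε he fun x => |f x|
  have h2 : ∑ x, ∑ y, a x y * (|f x| - |f y|) ^ 2 ≤ 2 * (d + t) * ∑ x, f x ^ 2 := by
    rw [← h.sum_mul_sq_add hf]
    refine Finset.sum_le_sum fun x _ => Finset.sum_le_sum fun y _ =>
      mul_le_mul_of_nonneg_left ?_ (h.nonneg x y)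
    rw [sq_le_sq]
    simpa using abs_abs_sub_abs_le_abs_sub (f x) (-f y)
  simp only [sq_abs] at h1
  have hn : (0 : ℝ) < Fintype.card V := Nat.cast_pos.2 Fintype.card_pos
  have hp : 0 ≤ Fintype.card V * ∑ x, f x ^ 2 :=
    mul_nonneg hn.le (Finset.sum_nonneg fun _ _ => sq_nonneg _)
  have h3 := mul_le_mul_of_nonneg_left h2 (mul_pos hn hd).le
  have h4 := mul_le_mul_of_nonneg_right ht hp
  have h5 : ε ^ 2 * (15 / 16 * (Fintype.card V * ∑ x, f x ^ 2)) ≤ ε ^ 2 * (∑ x, |f x|) ^ 2 := by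
    linarith
  exact le_of_mul_le_mul_left h5 (by positivity)

/-- Close to the bottom of the spectrum there are no two orthogonal eigenfunctions. -/
theorem false_of_orthogonal (h : RegularWeights a d) (hd : 0 < d) (hε : 0 < ε)
    (he : EdgeExpansion a ε) (hf : IsEigen a t f) (hg : IsEigen a t g)
    (ht : 32 * d * (d + t) ≤ ε ^ 2) (hf0 : f ≠ 0) (hfg : ∑ x, f x * g x = 0)
    (hn : ∑ x, f x ^ 2 = ∑ x, g x ^ 2) : False := by
  set N := ∑ x, f x ^ 2 with hN
  have hN0 : 0 < N := sum_sq_pos hf0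
  have hp : 0 < Fintype.card V * N := mul_pos (Nat.cast_pos.2 Fintype.card_pos) hN0
  have comb : ∀ p q : ℝ, p ^ 2 + q ^ 2 = 1 →
      15 / 16 * (Fintype.card V * N) ≤ (∑ x, |p * f x + q * g x|) ^ 2 := fun p q hpq => by
    have h1 := h.sum_sq_le_sum_abs hd hε he ((hf.smul p).add (hg.smul q)) ht
    have h2 : ∑ x, (p * f x + q * g x) ^ 2 = N := by
      have : ∀ x, (p * f x + q * g x) ^ 2 =
          p ^ 2 * f x ^ 2 + 2 * p * q * (f x * g x) + q ^ 2 * g x ^ 2 := fun x => by ring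
      simp_rw [this, Finset.sum_add_distrib, ← Finset.mul_sum]
      rw [hfg, ← hn, ← hN]
      linear_combination N * hpq
    simpa only [Pi.add_apply, Pi.smul_apply, smul_eq_mul, h2] using h1
  have lower : ∀ p q : ℝ, p ^ 2 + q ^ 2 = 1 →
      √(15 / 16 * (Fintype.card V * N)) ≤ ∑ x, |p * f x + q * g x| := fun p q hpq =>
    Real.sqrt_le_iff.2 ⟨Finset.sum_nonneg fun _ _ => abs_nonneg _, comb p q hpq⟩
  have l1 := lower 1 0 (by norm_num)
  have l2 := lower 0 1 (by norm_num)
  have l3 := lower (3 / 5) (4 / 5) (by norm_num)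
  have l4 := lower (4 / 5) (-3 / 5) (by norm_num)
  -- Two rational orthonormal bases of the plane spanned by `f` and `g`. All four unit combinations
  -- have large `ℓ¹` norm. Pointwise, however, a signed sum of the four coefficient vectors has
  -- squared length at most `(12/5)² + (6/5)² = 36/5`. Cauchy–Schwarz would then give `16 * 15/16 =
  -- 15 ≤ 2 * 36/5`, which is false.
  set F : V → ℝ := fun x => |1 * f x + 0 * g x| + |0 * f x + 1 * g x| +
    |3 / 5 * f x + 4 / 5 * g x| + |4 / 5 * f x + -3 / 5 * g x| with hF
  have hsum : 4 * √(15 / 16 * (Fintype.card V * N)) ≤ ∑ x, F x := by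
    simp only [hF, Finset.sum_add_distrib]
    linarith
  have hup : ∀ x, F x ^ 2 ≤ 36 / 5 * (f x ^ 2 + g x ^ 2) := fun x => by
    have cs : ∀ p q : ℝ, p ^ 2 + q ^ 2 ≤ 36 / 5 →
        (p * f x + q * g x) ^ 2 ≤ 36 / 5 * (f x ^ 2 + g x ^ 2) := fun p q hpq => by
      nlinarith [sq_nonneg (q * f x - p * g x),
        mul_nonneg (sub_nonneg.2 hpq) (add_nonneg (sq_nonneg (f x)) (sq_nonneg (g x)))]
    have e : ∃ s1 s2 s3 s4 : ℝ, (s1 = 1 ∨ s1 = -1) ∧ (s2 = 1 ∨ s2 = -1) ∧ (s3 = 1 ∨ s3 = -1) ∧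
        (s4 = 1 ∨ s4 = -1) ∧ F x = (s1 + 3 / 5 * s3 + 4 / 5 * s4) * f x +
          (s2 + 4 / 5 * s3 - 3 / 5 * s4) * g x := by
      have ab : ∀ z : ℝ, ∃ s : ℝ, (s = 1 ∨ s = -1) ∧ |z| = s * z := fun z => by
        rcases abs_choice z with hz | hz
        · exact ⟨1, Or.inl rfl, by rw [hz, one_mul]⟩
        · exact ⟨-1, Or.inr rfl, by rw [hz, neg_one_mul]⟩
      obtain ⟨s1, i1, e1⟩ := ab (1 * f x + 0 * g x)
      obtain ⟨s2, i2, e2⟩ := ab (0 * f x + 1 * g x)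
      obtain ⟨s3, i3, e3⟩ := ab (3 / 5 * f x + 4 / 5 * g x)
      obtain ⟨s4, i4, e4⟩ := ab (4 / 5 * f x + -3 / 5 * g x)
      exact ⟨s1, s2, s3, s4, i1, i2, i3, i4, by simp only [hF, e1, e2, e3, e4]; ring⟩
    obtain ⟨s1, s2, s3, s4, i1, i2, i3, i4, hFx⟩ := e
    rw [hFx]
    refine cs _ _ ?_
    rcases i1 with rfl | rfl <;> rcases i2 with rfl | rfl <;> rcases i3 with rfl | rfl <;>
      rcases i4 with rfl | rfl <;> norm_num
  have hcs : (∑ x, F x) ^ 2 ≤ Fintype.card V * ∑ x, F x ^ 2 := by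
    simpa using sq_sum_le_card_mul_sum_sq (s := Finset.univ) (f := F)
  have hF2 : ∑ x, F x ^ 2 ≤ 36 / 5 * (N + N) := by
    refine (Finset.sum_le_sum fun x _ => hup x).trans (le_of_eq ?_)
    rw [← Finset.mul_sum, Finset.sum_add_distrib, ← hn]
  have h1 := pow_le_pow_left₀ (by positivity) hsum 2
  rw [mul_pow, Real.sq_sqrt (by positivity)] at h1
  have h2 := mul_le_mul_of_nonneg_left hF2 (Nat.cast_nonneg (α := ℝ) (Fintype.card V))
  linarith

/-- Close to the bottom of the spectrum the eigenvalues are simple. -/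
theorem exists_eq_smul (h : RegularWeights a d) (hd : 0 < d) (hε : 0 < ε)
    (he : EdgeExpansion a ε) (hf : IsEigen a t f) (hg : IsEigen a t g)
    (ht : 32 * d * (d + t) ≤ ε ^ 2) (hf0 : f ≠ 0) : ∃ c : ℝ, g = c • f := by
  have hN := sum_sq_pos hf0
  set N := ∑ x, f x ^ 2 with hNdef
  set c := (∑ x, f x * g x) / N
  refine ⟨c, ?_⟩
  by_contra hne
  set k : V → ℝ := g + (-c) • f with hk
  have hk0 : k ≠ 0 := fun h0 => hne (by
    rw [hk, neg_smul, ← sub_eq_add_neg] at h0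
    exact sub_eq_zero.1 h0)
  have hK := sum_sq_pos hk0
  set K := ∑ x, k x ^ 2 with hKdef
  have horth : ∑ x, f x * k x = 0 := by
    have : ∀ x, f x * k x = f x * g x - c * f x ^ 2 := fun x => by
      simp only [hk, Pi.add_apply, Pi.smul_apply, smul_eq_mul]; ring
    simp_rw [this, Finset.sum_sub_distrib, ← Finset.mul_sum]
    rw [← hNdef, div_mul_cancel₀ _ hN.ne', sub_self]
  -- Scaling each function by the norm of the other equalises the norms.
  refine h.false_of_orthogonal hd hε he (hf.smul √K) ((hg.add (hf.smul (-c))).smul √N) ht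
    (smul_ne_zero (Real.sqrt_pos.2 hK).ne' hf0) ?_ ?_
  · have : ∀ x, (√K • f) x * (√N • k) x = √K * √N * (f x * k x) := fun x => by
      simp only [Pi.smul_apply, smul_eq_mul]; ring
    rw [← hk, Finset.sum_congr rfl fun x _ => this x, ← Finset.mul_sum, horth, mul_zero]
  · rw [← hk]
    simp only [Pi.smul_apply, smul_eq_mul, mul_pow, Real.sq_sqrt hK.le, Real.sq_sqrt hN.le,
      ← Finset.mul_sum]
    rw [← hNdef, ← hKdef, mul_comm]

/-- If the square of the adjacency operator is invariant under a transitive set of permutations,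
then an eigenvalue close to `-d` equals `-d`. -/
theorem eigenvalue_eq_neg (h : RegularWeights a d) (hd : 0 < d) (hε : 0 < ε)
    (he : EdgeExpansion a ε) (hint : ∀ x y, ∃ m : ℤ, a x y = m) (hdint : ∃ m : ℤ, d = m)
    (hsymm : ∀ x y, ∃ φ : Equiv.Perm V, φ x = y ∧ ∀ (F : V → ℝ) (z : V),
      ∑ v, a z v * ∑ w, a v w * F (φ w) = ∑ v, a (φ z) v * ∑ w, a v w * F w)
    (hf : IsEigen a t f) (hf0 : f ≠ 0) (ht : 32 * d * (d + t) ≤ ε ^ 2) (ht1 : d + t < 1) :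
    t = -d := by
  by_cases htd : -t = d
  · linarith
  -- An eigenvalue `-t ≠ d` this close to `d` would violate the gap at the top.
  have hneg : ∀ k, IsEigen a (-t) k → k = 0 := fun k hk => by
    by_contra hk0
    have h1 := h.gap_of_ne hd hε he hk hk0 htd
    nlinarith [pow_pos hε 2]
  obtain ⟨e, he0⟩ := Function.ne_iff.1 hf0
  have hsq : ∀ y, f y ^ 2 = f e ^ 2 := fun y => by
    obtain ⟨φ, hφ, hφ'⟩ := hsymm e y
    -- The translate is an eigenfunction of the square for `t ^ 2`; as `-t` is excluded, it belongs
    -- to `t`.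
    have hg : IsEigen a t fun x => f (φ x) := by
      refine IsEigen.of_sq (fun x => ?_) hneg
      rw [hφ' f x]
      simp only [hf _, mul_left_comm _ t, ← Finset.mul_sum]
      ring
    obtain ⟨c, hc⟩ := h.exists_eq_smul hd hε he hf hg ht hf0
    have hc' : ∀ x, f (φ x) = c * f x := fun x => congrFun hc x
    have h1 : ∑ x, f x ^ 2 = c ^ 2 * ∑ x, f x ^ 2 := by
      conv_lhs => rw [← Equiv.sum_comp φ]
      simp only [hc', mul_pow, ← Finset.mul_sum]
    have h2 : c ^ 2 = 1 := by
      have := sum_sq_pos hf0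
      exact mul_right_cancel₀ this.ne' (by rw [one_mul]; exact h1.symm)
    rw [← hφ, hc', mul_pow, h2, one_mul]
  have hsign : ∀ y, ∃ m : ℤ, f y = m * f e := fun y => by
    rcases sq_eq_sq_iff_eq_or_eq_neg.1 (hsq y) with h1 | h1
    · exact ⟨1, by simpa using h1⟩
    · exact ⟨-1, by simpa using h1⟩
  choose s hs using hsign
  choose b hb using hint
  obtain ⟨D, hD⟩ := hdint
  have ht' : t = ((∑ y, b e y * s y : ℤ) : ℝ) := by
    have h1 := hf e
    have h2 : ∀ y, a e y * f y = (b e y * s y : ℝ) * f e := fun y => by rw [hs y, hb e y]; ring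
    rw [Finset.sum_congr rfl fun y _ => h2 y, ← Finset.sum_mul] at h1
    have := mul_right_cancel₀ he0 h1
    rw [← this]
    push_cast
    rfl
  have hlow := h.neg_le_eigenvalue hf hf0
  rw [hD, ht'] at hlow ht1 ⊢
  have l1 : -D ≤ ∑ y, b e y * s y := by exact_mod_cast hlow
  have l2 : D + ∑ y, b e y * s y < 1 := by exact_mod_cast ht1
  have l3 : ∑ y, b e y * s y = -D := by omega
  exact_mod_cast l3

end RegularWeights

end Eigen

/-! ### Expansion of regular multigraphs -/

namespace MultiDigraph

variable {V : Type*} [Fintype V] {Γ Δ : MultiDigraph V} {d : ℕ} {ε δ : ℝ}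

theorem IsUndirected.regularWeights (hΓ : Γ.IsUndirected) (hd : ∀ x, ∑ y, Γ.arcs x y = d) :
    RegularWeights (fun x y => (Γ.arcs x y : ℝ)) d where
  nonneg x y := Nat.cast_nonneg _
  symm x y := by simp only [hΓ x y]
  sum_eq x := by exact_mod_cast hd x

theorem IsConnected.degree_pos (hc : Γ.IsConnected) (hΓ : Γ.IsUndirected)
    (hd : ∀ x, ∑ y, Γ.arcs x y = d) (hV : 2 ≤ Fintype.card V) : 0 < d := by
  rw [Nat.pos_iff_ne_zero]
  rintro rfl
  obtain ⟨x, y, hxy⟩ := Fintype.one_lt_card_iff.1 (by omega : 1 < Fintype.card V)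
  refine hxy (hc.induction hΓ (p := fun z => x = z) (fun u v huv _ => ?_) rfl y)
  exact absurd (Finset.sum_eq_zero_iff.1 (hd u) v (Finset.mem_univ v)) huv

variable [DecidableEq V]

/-- Every boundary vertex receives at least one edge from `W`. -/
theorem IsVertexExpander.edgeExpansion (h : Γ.IsVertexExpander ε) :
    EdgeExpansion (fun x y => (Γ.arcs x y : ℝ)) ε := by
  intro W hW hW2
  refine (h W hW hW2).trans ?_
  have h1 : (Γ.vertexBoundary W).card ≤
      ∑ y, ∑ x, if x ∈ W ∧ y ∉ W then Γ.arcs x y else 0 := by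
    rw [Finset.card_eq_sum_ones]
    refine (Finset.sum_le_sum fun y hy => ?_).trans
      (Finset.sum_le_sum_of_subset (Finset.subset_univ (Γ.vertexBoundary W)))
    obtain ⟨hyW, x, hx, hxy⟩ := (Finset.mem_filter.1 hy).2
    refine le_trans ?_ (Finset.single_le_sum (fun _ _ => Nat.zero_le _) (Finset.mem_univ x))
    rw [if_pos ⟨hx, hyW⟩]
    omega
  rw [Finset.sum_comm]
  refine (Nat.cast_le.2 h1).trans (le_of_eq ?_)
  push_cast
  rfl

theorem IsVertexExpander.le_degree (h : Γ.IsVertexExpander ε) (hd : ∀ x, ∑ y, Γ.arcs x y = d)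
    (hV : 2 ≤ Fintype.card V) : ε ≤ d := by
  obtain ⟨x⟩ : Nonempty V := Fintype.card_pos_iff.1 (by omega)
  have h1 := h.edgeExpansion {x} (Finset.singleton_nonempty x) (by simpa using hV)
  rw [Finset.card_singleton, Nat.cast_one, mul_one] at h1
  refine h1.trans ?_
  rw [Finset.sum_eq_single x (fun z _ hz => by simp [hz]) (by simp), ← hd x, Nat.cast_sum]
  exact Finset.sum_le_sum fun y _ => by split_ifs <;> simp

theorem IsVertexExpander.isConnected (h : Γ.IsVertexExpander ε) (hε : 0 < ε) [Nonempty V] :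
    Γ.IsConnected := by
  classical
  have key : ∀ W : Finset V, W.Nonempty → 2 * W.card ≤ Fintype.card V →
      ∃ x ∈ W, ∃ y ∉ W, Γ.arcs x y ≠ 0 := fun W hW hW2 => by
    by_contra hcon
    push Not at hcon
    have h1 := h W hW hW2
    have h2 : Γ.vertexBoundary W = ∅ := by
      refine Finset.filter_eq_empty_iff.2 fun y _ hy => ?_
      obtain ⟨hyW, x, hx, hxy⟩ := hy
      exact hxy (hcon x hx y hyW)
    rw [h2, Finset.card_empty, Nat.cast_zero] at h1
    have := mul_pos hε (Nat.cast_pos.2 hW.card_pos : (0 : ℝ) < W.card)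
    linarith
  refine ⟨fun u v => ?_⟩
  by_contra huv
  have hstep : ∀ x y, Γ.arcs x y ≠ 0 →
      (Γ.toSimpleGraph.Reachable u x ↔ Γ.toSimpleGraph.Reachable u y) := fun x y hxy => by
    have : Γ.toSimpleGraph.Reachable x y := SimpleGraph.reachable_of_edist_ne_top
      (ne_top_of_le_ne_top (ENat.natCast_ne_top 1) (edist_toSimpleGraph_le_one hxy))
    exact ⟨fun hx => hx.trans this, fun hy => hy.trans this.symm⟩
  set W := Finset.univ.filter fun x => Γ.toSimpleGraph.Reachable u x with hW
  have mW : ∀ x, x ∈ W ↔ Γ.toSimpleGraph.Reachable u x := fun x => by simp [hW]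
  have hc := Finset.card_add_card_compl W
  rcases le_total (2 * W.card) (Fintype.card V) with h1 | h1
  · obtain ⟨x, hx, y, hy, hxy⟩ := key W ⟨u, (mW u).2 (SimpleGraph.Reachable.refl u)⟩ h1
    exact hy ((mW y).2 ((hstep x y hxy).1 ((mW x).1 hx)))
  · obtain ⟨x, hx, y, hy, hxy⟩ := key Wᶜ ⟨v, by rw [Finset.mem_compl, mW]; exact huv⟩ (by omega)
    rw [Finset.mem_compl, mW] at hx
    rw [Finset.mem_compl, not_not, mW] at hy
    exact hx ((hstep x y hxy).2 hy)

theorem IsBipartite.neg_mem_spectrum [Nonempty V] (h : Γ.IsBipartite)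
    (hd : ∀ x, ∑ y, Γ.arcs x y = d) : -(d : ℝ) ∈ Γ.spectrum := by
  obtain ⟨c, hc⟩ := h
  refine mem_spectrum_iff.2 ⟨fun x => if c x then 1 else -1, ?_, fun x => ?_⟩
  · obtain ⟨x⟩ := ‹Nonempty V›
    refine Function.ne_iff.2 ⟨x, ?_⟩
    cases c x <;> simp
  · have : ∀ y, (Γ.arcs x y : ℝ) * (if c y then 1 else -1) =
        (Γ.arcs x y : ℝ) * -(if c x then 1 else -1) := fun y => by
      by_cases hxy : Γ.arcs x y = 0
      · simp [hxy]
      · have := hc x y hxy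
        revert this
        cases c x <;> cases c y <;> simp
    rw [Finset.sum_congr rfl fun y _ => this y, ← Finset.sum_mul, ← Nat.cast_sum, hd x]
    ring

/-- For the eigenvalue `-d` the sum of `(f x + f y) ^ 2` over the edges vanishes, so `f` changes
sign along every edge. By connectedness it has no zero, and its sign is a colouring. -/
theorem IsConnected.isBipartite_of_neg_mem_spectrum (hc : Γ.IsConnected) (hΓ : Γ.IsUndirected)
    (hd : ∀ x, ∑ y, Γ.arcs x y = d) (h : -(d : ℝ) ∈ Γ.spectrum) : Γ.IsBipartite := by
  obtain ⟨f, hf0, hf⟩ := mem_spectrum_iff.1 h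
  have h1 := (hΓ.regularWeights hd).sum_mul_sq_add (f := f) hf
  rw [add_neg_cancel, mul_zero, zero_mul] at h1
  have hnn : ∀ x y, 0 ≤ (Γ.arcs x y : ℝ) * (f x + f y) ^ 2 := fun x y =>
    mul_nonneg (Nat.cast_nonneg _) (sq_nonneg _)
  have hedge : ∀ x y, Γ.arcs x y ≠ 0 → f y = -f x := fun x y hxy => by
    have h2 := (Finset.sum_eq_zero_iff_of_nonneg
      fun x _ => Finset.sum_nonneg fun y _ => hnn x y).1 h1 x (Finset.mem_univ x)
    have h3 := (Finset.sum_eq_zero_iff_of_nonneg fun y _ => hnn x y).1 h2 y (Finset.mem_univ y)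
    have h4 : (f x + f y) ^ 2 = 0 :=
      (mul_eq_zero.1 h3).resolve_left (Nat.cast_ne_zero.2 hxy)
    have := pow_eq_zero_iff (two_ne_zero) |>.1 h4
    linarith
  obtain ⟨e, he⟩ := Function.ne_iff.1 hf0
  have hne : ∀ x, f x ≠ 0 := hc.induction hΓ (p := fun x => f x ≠ 0)
    (fun x y hxy hx => by rw [hedge x y hxy]; exact neg_ne_zero.2 hx) he
  refine ⟨fun x => decide (0 < f x), fun x y hxy hcol => ?_⟩
  have h2 : 0 < f x ↔ 0 < f y := by simpa using hcol
  rw [hedge x y hxy] at h2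
  rcases lt_or_gt_of_ne (hne x) with h3 | h3
  · have := h2.2 (by linarith); linarith
  · have := h2.1 h3; linarith

theorem IsTwoSidedExpander.strict (h : Γ.IsTwoSidedExpander d ε) (hΓ : Γ.IsUndirected)
    (hd : ∀ x, ∑ y, Γ.arcs x y = d) (hb : ¬ Γ.IsBipartite) :
    Γ.IsStrictTwoSidedExpander d ε :=
  ⟨h.1, fun t ht htd => h.2 t ht htd fun h' =>
    hb (h.1.isBipartite_of_neg_mem_spectrum hΓ hd (h' ▸ ht))⟩

theorem _root_.neg_mem_Ioo_of_mem {t ε : ℝ} (h : t ∈ Set.Ioo (-1 + ε) (1 - ε)) :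
    -t ∈ Set.Ioo (-1 + ε) (1 - ε) :=
  ⟨by linarith [h.2], by linarith [h.1]⟩

namespace IsTwist

variable {τ : V → V} {e : V}

theorem isTwoSidedExpander (h : IsTwist τ Γ Δ) (he : τ e = e)
    (hΓ : Γ.IsTwoSidedExpander d ε) : Δ.IsTwoSidedExpander d ε := by
  refine ⟨h.symm.isConnected he hΓ.1, fun t ht h1 h2 => ?_⟩
  rcases h.mem_spectrum_or_neg_mem ht with ht | ht
  · exact hΓ.2 t ht h1 h2
  · have := neg_mem_Ioo_of_mem (hΓ.2 (-t) ht (fun h' => h2 (by linarith))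
      (fun h' => h1 (by linarith)))
    rwa [neg_div, neg_neg] at this

/-- The strict notion excludes the eigenvalue `-d`, hence bipartiteness, and non-bipartiteness is
inherited by the twist. -/
theorem isStrictTwoSidedExpander (h : IsTwist τ Γ Δ) (he : τ e = e)
    (hdΔ : ∀ x, ∑ y, Δ.arcs x y = d) (hdΓ : ∀ x, ∑ y, Γ.arcs x y = d)
    (hV : 2 ≤ Fintype.card V) (hε : 0 < ε)
    (hΓ : Γ.IsStrictTwoSidedExpander d ε) : Δ.IsStrictTwoSidedExpander d ε := by
  have hd := hΓ.1.degree_pos h.left hdΓ hV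
  have hd' : (d : ℝ) ≠ 0 := Nat.cast_ne_zero.2 hd.ne'
  have : Nonempty V := ⟨e⟩
  refine IsTwoSidedExpander.strict
    (h.isTwoSidedExpander he ⟨hΓ.1, fun t ht h1 _ => hΓ.2 t ht h1⟩) h.right hdΔ fun hb => ?_
  have hbΓ := h.isBipartite he (h.symm.isConnected he hΓ.1) hb
  have h1 := (hΓ.2 _ (hbΓ.neg_mem_spectrum hdΓ) fun h' => hd' (by linarith)).1
  rw [neg_div, div_self hd'] at h1
  linarith

end IsTwist

/-- Vertex expansion forces two-sided expansion, as soon as the square of the adjacency operator is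
invariant under a transitive set of permutations. -/
theorem IsVertexExpander.isTwoSidedExpander (h : Γ.IsVertexExpander ε) (hε : 0 < ε)
    (hΓ : Γ.IsUndirected) (hd : ∀ x, ∑ y, Γ.arcs x y = d) (hd0 : 0 < d) [Nonempty V]
    (hsymm : ∀ x y, ∃ φ : Equiv.Perm V, φ x = y ∧ ∀ (F : V → ℝ) (z : V),
      ∑ v, (Γ.arcs z v : ℝ) * ∑ w, (Γ.arcs v w : ℝ) * F (φ w) =
        ∑ v, (Γ.arcs (φ z) v : ℝ) * ∑ w, (Γ.arcs v w : ℝ) * F w)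
    (hδ : 32 * (d : ℝ) ^ 2 * δ ≤ ε ^ 2) (hδ1 : d * δ < 1) :
    Γ.IsTwoSidedExpander d δ := by
  have hdR : (0 : ℝ) < d := Nat.cast_pos.2 hd0
  have hw := hΓ.regularWeights hd
  have he := h.edgeExpansion
  refine ⟨h.isConnected hε, fun t ht h1 h2 => ?_⟩
  obtain ⟨f, hf0, hf⟩ := mem_spectrum_iff.1 ht
  constructor
  · by_contra hcon
    rw [not_lt, div_le_iff₀ hdR] at hcon
    have h3 : d + t ≤ d * δ := by linarith
    have h4 := mul_le_mul_of_nonneg_left h3 hdR.le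
    exact h2 (hw.eigenvalue_eq_neg hdR hε he (fun x y => ⟨Γ.arcs x y, by simp⟩)
      ⟨d, by simp⟩ hsymm hf hf0 (by linarith) (by linarith))
  · by_contra hcon
    rw [not_lt, le_div_iff₀ hdR] at hcon
    have h3 : d - t ≤ d * δ := by linarith
    have h4 := mul_le_mul_of_nonneg_left h3 hdR.le
    have h5 := hw.gap_of_ne hdR hε he hf hf0 h1
    have := pow_pos hε 2
    linarith

end MultiDigraph

/-! ### The four Cayley-type graphs -/

namespace CayleyKind

variable {G : Type*} [Group G] {σ : MulAut G}

theorem involutive_of_orderOf_eq_two (hσ : orderOf σ = 2) (x : G) : σ (σ x) = x := by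
  have h := pow_orderOf_eq_one σ
  rw [hσ, sq] at h
  exact DFunLike.congr_fun h x

theorem involution_one (i j : CayleyKind) : involution σ i j (1 : G) = 1 := by
  cases i <;> cases j <;> simp [involution]

theorem involutive_involution (hσ : ∀ x, σ (σ x) = x) (i j : CayleyKind) :
    Function.Involutive (involution (G := G) σ i j) := fun x => by
  cases i <;> cases j <;> simp [involution, hσ]

/-- The label of the edges from `x` to `y`. -/
def label (σ : MulAut G) : CayleyKind → G → G → G
  | cayley, x, y => x⁻¹ * y
  | cayleySum, x, y => x * y
  | twisted, x, y => x⁻¹ * σ y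
  | twistedSum, x, y => x * σ y

theorem target_eq_iff (hσ : ∀ x, σ (σ x) = x) (k : CayleyKind) (x s y : G) :
    k.target σ x s = y ↔ s = k.label σ x y := by
  have hs : ∀ u, σ u = y ↔ u = σ y := fun u =>
    ⟨fun h => by rw [← h, hσ], fun h => by rw [h, hσ]⟩
  cases k <;> simp only [target, label, hs]
  · exact eq_inv_mul_iff_mul_eq.symm
  · exact inv_mul_eq_iff_eq_mul
  · exact eq_inv_mul_iff_mul_eq.symm
  · exact inv_mul_eq_iff_eq_mul

variable [DecidableEq G] {S : Multiset G}

theorem arcs_eq_count (hσ : ∀ x, σ (σ x) = x) (k : CayleyKind) (x y : G) :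
    (k.graph σ S).arcs x y = S.count (k.label σ x y) := by
  have hinj : Function.Injective fun s => k.target σ x s := fun s s' h => by
    rw [(target_eq_iff hσ k x s _).1 rfl]
    exact ((target_eq_iff hσ k x s' _).1 h.symm).symm
  have h : k.target σ x (k.label σ x y) = y := (target_eq_iff hσ k x _ y).2 rfl
  conv_lhs => rw [← h]
  exact Multiset.count_map_eq_count' _ _ hinj _

theorem count_inv_of_cayley (hσ : ∀ x, σ (σ x) = x) (h : (cayley.graph σ S).IsUndirected)
    (z : G) : S.count z⁻¹ = S.count z := by
  have := h z 1
  simpa [arcs_eq_count hσ, label] using this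

theorem count_mul_comm_of_cayleySum (hσ : ∀ x, σ (σ x) = x)
    (h : (cayleySum.graph σ S).IsUndirected) (z w : G) : S.count (z * w) = S.count (w * z) := by
  have := h z w
  simpa [arcs_eq_count hσ, label] using this

theorem count_map_of_twisted (hσ : ∀ x, σ (σ x) = x) (h : (twisted.graph σ S).IsUndirected)
    (z : G) : S.count (σ z) = S.count z⁻¹ := by
  have := h 1 z
  simpa [arcs_eq_count hσ, label] using this

theorem count_map_of_twistedSum (hσ : ∀ x, σ (σ x) = x)
    (h : (twistedSum.graph σ S).IsUndirected) (z : G) : S.count (σ z) = S.count z := by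
  have := h 1 z
  simpa [arcs_eq_count hσ, label] using this

theorem count_mul_comm_of_twistedSum (hσ : ∀ x, σ (σ x) = x)
    (h : (twistedSum.graph σ S).IsUndirected) (z w : G) : S.count (z * w) = S.count (w * z) := by
  have h1 := h z (σ w)
  simp only [arcs_eq_count hσ, label, hσ] at h1
  rw [h1, ← count_map_of_twistedSum hσ h (w * z), map_mul]

/-- Undirectedness amounts to invariance of the multiplicities in `S`. For kinds that differ by `σ`,
the twist identity needs their `σ`-invariance: an undirected twisted sum graph gives it directly, an
undirected twisted graph only together with symmetry of `S`. -/
theorem isTwist_graph (hσ : ∀ x, σ (σ x) = x) (i j : CayleyKind)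
    (hi : (i.graph σ S).IsUndirected) (hj : (j.graph σ S).IsUndirected)
    (hS : (i = cayleySum ∧ j = twisted) ∨ (i = twisted ∧ j = cayleySum) →
      S.map (fun s => s⁻¹) = S) :
    MultiDigraph.IsTwist (involution σ i j) (i.graph σ S) (j.graph σ S) := by
  refine ⟨involutive_involution hσ i j, hi, hj, fun x y => ?_⟩
  have hinv : S.map (fun s => s⁻¹) = S → ∀ z, S.count z⁻¹ = S.count z := fun h z => by
    conv_lhs => rw [← h]
    exact Multiset.count_map_eq_count' _ _ inv_injective _
  rw [arcs_eq_count hσ, arcs_eq_count hσ]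
  have hmove : (∀ z, S.count (σ z) = S.count z) →
      S.count (x⁻¹ * σ y) = S.count ((σ x)⁻¹ * y) ∧ S.count (x * σ y) = S.count (σ x * y) := fun h =>
    ⟨by rw [← h, map_mul, map_inv, hσ], by rw [← h, map_mul, hσ]⟩
  have hmove' : (∀ z, S.count (σ z) = S.count z) →
      S.count (x⁻¹ * y) = S.count ((σ x)⁻¹ * σ y) ∧ S.count (x * y) = S.count (σ x * σ y) := fun h =>
    ⟨by rw [← h, map_mul, map_inv], by rw [← h, map_mul]⟩
  have htw : (∀ z, S.count z⁻¹ = S.count z) → (twisted.graph σ S).IsUndirected →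
      ∀ z, S.count (σ z) = S.count z := fun h h' z => by rw [count_map_of_twisted hσ h', h]
  cases i <;> cases j <;> simp only [label, involution, inv_inv]
  · exact (hmove (htw (count_inv_of_cayley hσ hi) hj)).1
  · exact (hmove (count_map_of_twistedSum hσ hj)).2
  · exact (hmove (htw (hinv (hS (Or.inl ⟨rfl, rfl⟩))) hj)).1
  · exact (hmove (count_map_of_twistedSum hσ hj)).2
  · exact (hmove' (htw (count_inv_of_cayley hσ hj) hi)).1
  · exact (hmove' (htw (hinv (hS (Or.inr ⟨rfl, rfl⟩))) hi)).2
  · exact (hmove' (count_map_of_twistedSum hσ hi)).1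
  · exact (hmove' (count_map_of_twistedSum hσ hi)).2

theorem map_conj_eq (h : ∀ z w, S.count (z * w) = S.count (w * z)) (g : G) :
    S.map (fun s => g * s * g⁻¹) = S := by
  ext z
  have h1 : g * (g⁻¹ * z * g) * g⁻¹ = z := by group
  conv_lhs => rw [← h1]
  rw [Multiset.count_map_eq_count' (fun s => g * s * g⁻¹) S (MulAut.conj g).injective,
    h (g⁻¹ * z) g, mul_inv_cancel_left]

variable [Fintype G]

theorem sum_arcs_mul (k : CayleyKind) (x : G) (F : G → ℝ) :
    ∑ y, ((k.graph σ S).arcs x y : ℝ) * F y = (S.map fun s => F (k.target σ x s)).sum := by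
  simp only [graph]
  rw [← Function.comp_def F, ← Multiset.map_map]
  generalize S.map (fun s => k.target σ x s) = M
  induction M using Multiset.induction_on with
  | empty => simp
  | cons b M ih =>
    simp [Multiset.count_cons, add_mul, Finset.sum_add_distrib, ih, add_comm]

theorem sum_arcs (k : CayleyKind) (x : G) : ∑ y, (k.graph σ S).arcs x y = S.card := by
  have := k.sum_arcs_mul (σ := σ) (S := S) x fun _ => 1
  simp only [mul_one, Multiset.map_const', Multiset.sum_replicate, nsmul_eq_mul] at this
  exact_mod_cast this

/-- The square of the adjacency operator commutes with left translations. -/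
theorem exists_perm_sq (hσ : ∀ x, σ (σ x) = x) (k : CayleyKind)
    (hk : (k.graph σ S).IsUndirected) (x y : G) :
    ∃ φ : Equiv.Perm G, φ x = y ∧ ∀ (F : G → ℝ) (z : G),
      ∑ v, ((k.graph σ S).arcs z v : ℝ) * ∑ w, ((k.graph σ S).arcs v w : ℝ) * F (φ w) =
        ∑ v, ((k.graph σ S).arcs (φ z) v : ℝ) * ∑ w, ((k.graph σ S).arcs v w : ℝ) * F w := by
  set g := y * x⁻¹
  refine ⟨Equiv.mulLeft g, by simp [g], fun F z => ?_⟩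
  have hconj : (∀ z w, S.count (z * w) = S.count (w * z)) → ∀ H : G → ℝ,
      (S.map H).sum = (S.map fun s => H (g * s * g⁻¹)).sum := fun h H => by
    conv_lhs => rw [← map_conj_eq h g, Multiset.map_map]
    rfl
  simp only [sum_arcs_mul, Equiv.coe_mulLeft]
  -- Two steps from `x` lead to `x * s * s'` or `x * s * σ s'`, which commutes with left
  -- translation. In the sum graphs they lead to `s⁻¹ * x * s'` or `s⁻¹ * x * σ s'`, and the
  -- translation is moved past `s⁻¹` by conjugating `s`, which preserves `S`.
  cases k with
  | cayley => simp only [target, mul_assoc]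
  | twisted => simp only [target, map_mul, hσ, mul_assoc]
  | cayleySum =>
    refine Eq.trans ?_ (hconj (count_mul_comm_of_cayleySum hσ hk) _).symm
    simp only [target, mul_inv_rev, inv_inv, mul_assoc, inv_mul_cancel_left]
  | twistedSum =>
    refine Eq.trans ?_ (hconj (count_mul_comm_of_twistedSum hσ hk) _).symm
    simp only [target, map_mul, map_inv, hσ, mul_inv_rev, inv_inv, mul_assoc, inv_mul_cancel_left]

end CayleyKind

theorem mainTheorem2 {G : Type*} [Group G] [Fintype G] [DecidableEq G]
    (hG : 4 ≤ Fintype.card G) (σ : MulAut G) (hσ : orderOf σ = 2)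
    (S : Multiset G) (d : ℕ) (hd : S.card = d) (i j : CayleyKind)
    (hi : (i.graph σ S).IsUndirected) (hj : (j.graph σ S).IsUndirected)
    (hS : (i = CayleyKind.cayleySum ∧ j = CayleyKind.twisted) ∨
        (i = CayleyKind.twisted ∧ j = CayleyKind.cayleySum) →
      S.map (fun s => s⁻¹) = S) :
    -- the spectra agree up to signs, with a precise count of the signs
    (∃ Eip Eim Ejp Ejm : Multiset ℝ,
        (i.graph σ S).spectrum = Eip + Eim ∧
        (j.graph σ S).spectrum = Ejp + Ejm ∧
        Eip = Ejp ∧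
        Eim = Ejm.map (fun t => -t) ∧
        2 * Eip.card = Fintype.card G + CayleyKind.fixedCount σ i j ∧
        2 * Eim.card + CayleyKind.fixedCount σ i j = Fintype.card G) ∧
    -- connectedness
    ((i.graph σ S).IsConnected ↔ (j.graph σ S).IsConnected) ∧
    -- connectedness together with bipartiteness
    (((i.graph σ S).IsConnected ∧ (i.graph σ S).IsBipartite) ↔
      ((j.graph σ S).IsConnected ∧ (j.graph σ S).IsBipartite)) ∧
    -- two-sided expansion, for both conventions on the eigenvalue `-1`
    (∀ ε : ℝ, 0 < ε →
      ((i.graph σ S).IsTwoSidedExpander d ε ↔ (j.graph σ S).IsTwoSidedExpander d ε) ∧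
      ((i.graph σ S).IsStrictTwoSidedExpander d ε ↔
        (j.graph σ S).IsStrictTwoSidedExpander d ε)) ∧
    -- diameters
    ((i.graph σ S).IsConnected → (j.graph σ S).IsConnected →
      (i.graph σ S).diam ≤ 2 * (j.graph σ S).diam ∧
      (j.graph σ S).diam ≤ 2 * (i.graph σ S).diam) ∧
    -- vertex expansion of one graph forces two-sided expansion of the other
    (∀ ε : ℝ, 0 < ε → (i.graph σ S).IsVertexExpander ε →
      0 < ε ^ 4 / (2 ^ (9 + i.eta) * (d : ℝ) ^ 8) ∧
      (j.graph σ S).IsTwoSidedExpander d (ε ^ 4 / (2 ^ (9 + i.eta) * (d : ℝ) ^ 8)) ∧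
      (¬ (i.graph σ S).IsBipartite →
        (j.graph σ S).IsStrictTwoSidedExpander d
          (ε ^ 4 / (2 ^ (9 + i.eta) * (d : ℝ) ^ 8)))) := by
  have hσ' := CayleyKind.involutive_of_orderOf_eq_two hσ
  have hT := CayleyKind.isTwist_graph hσ' i j hi hj hS
  have h1 := CayleyKind.involution_one (σ := σ) i j
  have hdi : ∀ x, ∑ y, (i.graph σ S).arcs x y = d := fun x => (i.sum_arcs x).trans hd
  have hdj : ∀ x, ∑ y, (j.graph σ S).arcs x y = d := fun x => (j.sum_arcs x).trans hd
  have hV : 2 ≤ Fintype.card G := by omega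
  refine ⟨?_, ⟨hT.symm.isConnected h1, hT.isConnected h1⟩,
    ⟨fun h => ⟨hT.symm.isConnected h1 h.1, hT.symm.isBipartite h1 h.1 h.2⟩,
      fun h => ⟨hT.isConnected h1 h.1, hT.isBipartite h1 h.1 h.2⟩⟩,
    fun ε hε => ⟨⟨hT.isTwoSidedExpander h1, hT.symm.isTwoSidedExpander h1⟩,
      ⟨hT.isStrictTwoSidedExpander h1 hdj hdi hV hε,
        hT.symm.isStrictTwoSidedExpander h1 hdi hdj hV hε⟩⟩,
    fun hci hcj => ⟨hT.diam_le h1 hcj, hT.symm.diam_le h1 hci⟩, fun ε hε hexp => ?_⟩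
  · obtain ⟨P, M, hP, hM, hc1, hc2⟩ := hT.exists_spectrum_eq
    refine ⟨P, M, P, M.map fun t => -t, hP, hM, rfl, ?_, hc1, hc2⟩
    simp
  have hεd := hexp.le_degree hdi hV
  have hdR : (0 : ℝ) < d := hε.trans_le hεd
  have hd1 : (1 : ℝ) ≤ d := by
    have : 0 < d := by exact_mod_cast hdR
    exact_mod_cast this
  set δ : ℝ := ε ^ 4 / (2 ^ (9 + i.eta) * (d : ℝ) ^ 8) with hδ
  have hδ0 : 0 < δ := by positivity
  -- The prescribed `δ` is much smaller than needed: only `32 * d ^ 2 * δ ≤ ε ^ 2` and `d * δ < 1`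
  -- matter, and both follow from this bound and `ε ≤ d`.
  have hδle : δ * (512 * (d : ℝ) ^ 6) ≤ ε ^ 2 := by
    have h2 : δ ≤ ε ^ 4 / (2 ^ 9 * (d : ℝ) ^ 8) := by
      rw [hδ]
      gcongr
      · norm_num
      · omega
    have h3 : ε ^ 4 ≤ ε ^ 2 * (d : ℝ) ^ 2 := by
      rw [show ε ^ 4 = ε ^ 2 * ε ^ 2 by ring]
      gcongr
    rw [le_div_iff₀ (by positivity)] at h2
    have h4 : (δ * (512 * (d : ℝ) ^ 6)) * (d : ℝ) ^ 2 ≤ ε ^ 2 * (d : ℝ) ^ 2 := by linarith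
    exact le_of_mul_le_mul_right h4 (by positivity)
  have hδ1 : 32 * (d : ℝ) ^ 2 * δ ≤ ε ^ 2 := by
    have h2 : (d : ℝ) ^ 2 ≤ (d : ℝ) ^ 6 := pow_le_pow_right₀ hd1 (by norm_num)
    have h3 := mul_le_mul_of_nonneg_left h2 hδ0.le
    have h4 : 0 ≤ δ * (d : ℝ) ^ 6 := by positivity
    linarith
  have hδ2 : d * δ < 1 := by
    have h2 : (d : ℝ) ^ 3 ≤ (d : ℝ) ^ 6 := pow_le_pow_right₀ hd1 (by norm_num)
    have h3 : ε ^ 2 ≤ (d : ℝ) ^ 2 := by gcongr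
    have h4 := mul_le_mul_of_nonneg_left h2 hδ0.le
    have h5 : (512 * (d * δ)) * (d : ℝ) ^ 2 ≤ 1 * (d : ℝ) ^ 2 := by
      have : 0 ≤ δ * (d : ℝ) ^ 6 := by positivity
      linarith
    have h6 := le_of_mul_le_mul_right h5 (by positivity)
    linarith
  have hXi := hexp.isTwoSidedExpander hε hi hdi (by exact_mod_cast hdR)
    (CayleyKind.exists_perm_sq hσ' i hi) hδ1 hδ2
  exact ⟨hδ0, hT.isTwoSidedExpander h1 hXi, fun hb =>
    hT.isStrictTwoSidedExpander h1 hdj hdi hV hδ0 (hXi.strict hi hdi hb)⟩
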